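/- Conventions. A polynomial $p\in S[X]$ over a commutative ring $S$ is separable if $rp+sp'=1$ for some $r,s\in S[X]$. A triangular separable algebra over a field $K$ is a $K$-algebra $R=K[a_1,\dots,a_l]$ ($l\ge 0$) obtained from $K$ by successive extensions: with $R_0=K$, for $1\le j\le l$ one sets $R_j=R_{j-1}[a_j]=R_{j-1}[X]/\langle p_j\rangle$, where $p_j=p_j(a_1,\dots,a_{j-1},X)\in R_{j-1}[X]$ is monic, separable and non-constant, and $R=R_l$; the list $p_1,\dots,p_l$ is part of the data. Put $m_j=\deg p_j$. A commutative $K$-algebra $A$ splits $R$ if there is a family of elements $a_{i_1,\dots,i_j}\in A$ ($1\le j\le l$, $1\le i_t\le m_t$) such that over $A$ $$p_1(X)=\prod_{d=1}^{m_1}(X-a_d)$$ and, for all $1\le j<l$ and all $i_1,\dots,i_j$, $$p_{j+1}(a_{i_1},a_{i_1,i_2},\dots,a_{i_1,\dots,i_j},X)=\prod_{d=1}^{m_{j+1}}(X-a_{i_1,\dots,i_j,d}).$$ Theorem. Let $K$ be a field of characteristic $0$ and let $F(X,Y)=Y^n+\sum_{i=1}^n\alpha_i(X)Y^{n-i}\in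 K[[X]][Y]$ be a monic non-constant polynomial that is separable over $K((X))$. Then there exists a triangular separable algebra $R$ over $K$ such that (1) there are an integer $m>0$ and $\eta_1,\dots,\eta_n\in R[[T]]$ with $$F(T^m,Y)=\prod_{i=1}^n (Y-\eta_i);$$ (2) if $A$ is any triangular separable algebra over $K$ such that $F(X,Y)$ factors linearly over $A[[X^{1/s}]]$ for some positive integer $s$, i.e. $F(U^s,Y)=\prod_{i=1}^n(Y-\mu_i)$ with $\mu_i\in A[[U]]$, then $A$ splits $R$. -/

import Mathlib

open Polynomial

universe u v

/-- A presentation `p₁(X₁), p₂(X₁, X₂), …, pₗ(X₁, …, Xₗ)` of a triangular separable algebra over a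
commutative ring `k`. Either the list is empty, or it consists of a monic, separable, non-constant
polynomial `p = p₁` in `k[X]` followed by a presentation over `k[a₁] = k[X]/(p₁)` of the
remaining steps. -/
inductive TriangularSeparable : (k : Type u) → [CommRing k] → Type (u + 1)
  | nil {k : Type u} [CommRing k] : TriangularSeparable k
  | cons {k : Type u} [CommRing k] (p : k[X]) (monic : p.Monic) (separable : p.Separable)
      (nonconstant : 0 < p.natDegree) (tail : TriangularSeparable (AdjoinRoot p)) :
      TriangularSeparable k

namespace TriangularSeparable

/-- The underlying type of the algebra `k[a₁, …, aₗ]` presented by a list `p₁, …, pₗ`. -/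
def Alg : {k : Type u} → [CommRing k] → TriangularSeparable k → Type u
  | _, _, @nil k _ => k
  | _, _, @cons _ _ _ _ _ _ T => T.Alg

@[reducible]
noncomputable def commRingAlg :
    {k : Type u} → [CommRing k] → (R : TriangularSeparable k) → CommRing R.Alg
  | _, _, @nil _ inst => inst
  | _, _, @cons _ _ _ _ _ _ T => T.commRingAlg

noncomputable instance {k : Type u} [CommRing k] (R : TriangularSeparable k) : CommRing R.Alg :=
  R.commRingAlg

/-- The structure map `k → k[a₁, …, aₗ]`: the composite of the structure maps of all steps. -/
noncomputable def ofBase :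
    {k : Type u} → [CommRing k] → (R : TriangularSeparable k) → k →+* R.Alg
  | _, _, @nil k _ => RingHom.id k
  | _, _, @cons _ _ p _ _ _ T => T.ofBase.comp (AdjoinRoot.of p)

noncomputable instance {k : Type u} [CommRing k] (R : TriangularSeparable k) :
    Algebra k R.Alg :=
  R.ofBase.toAlgebra

theorem eval₂_eq_zero_of_map_eq_prod {k : Type u} [CommRing k] {A : Type v} [CommRing A]
    (φ : k →+* A) {p : k[X]} {m : ℕ} {a : Fin m → A}
    (h : p.map φ = ∏ d, (X - C (a d))) (d : Fin m) : p.eval₂ φ (a d) = 0 := by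
  rw [← eval_map, h, eval_prod]
  exact Finset.prod_eq_zero (Finset.mem_univ d) (by simp)

/-- `R.SplitBy φ`: the `k`-algebra `A` (with structure map `φ : k → A`) splits the triangular
separable algebra `R = k[a₁, …, aₗ], p₁, …, pₗ`, where `pᵢ` has degree `mᵢ`. There are elements
`a_{i₁}` of `A`, `i₁ < m₁`, with `p₁ = ∏ d, (X - a_d)` over `A`; and for each `i₁` the
homomorphism `k[a₁] → A`, `a₁ ↦ a_{i₁}`, again makes `A` split the remaining steps, i.e. there
are `a_{i₁,i₂}` with `p₂(a_{i₁}, X) = ∏ d, (X - a_{i₁,d})`, and so on. The elements chosen at all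
stages together form the family `a_{i₁,…,iⱼ}` (`1 ≤ j ≤ l`). -/
def SplitBy {A : Type v} [CommRing A] :
    {k : Type u} → [CommRing k] → TriangularSeparable k → (k →+* A) → Prop
  | _, _, @nil _ _, _ => True
  | _, _, @cons _ _ p _ _ _ T, φ =>
      ∃ (a : Fin p.natDegree → A) (h : p.map φ = ∏ d, (X - C (a d))),
        ∀ d, T.SplitBy (AdjoinRoot.lift φ (a d) (eval₂_eq_zero_of_map_eq_prod φ h d))

/-- `A.Splits R`: the triangular separable `K`-algebra `A` splits `R`. -/
def Splits {K : Type u} [CommRing K] (A R : TriangularSeparable K) : Prop :=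
  R.SplitBy (algebraMap K A.Alg)

end TriangularSeparable

/-- For `F(X, Y)` in `K[[X]][Y]`, the polynomial `F(Tᵐ, Y)` in `A[[T]][Y]`. -/
noncomputable def substPow {K : Type u} [CommRing K] (A : Type v) [CommRing A] [Algebra K A]
    (F : (PowerSeries K)[X]) (m : ℕ) (hm : m ≠ 0) : (PowerSeries A)[X] :=
  F.map ((PowerSeries.map (algebraMap K A)).comp
    (PowerSeries.expand m hm : PowerSeries K →ₐ[K] PowerSeries K).toRingHom)

/-- With `n` the degree of `F` in `Y`, `F(Tᵐ, Y) = ∏_{i<n} (Y - ηᵢ)` for some `ηᵢ` in `A[[T]]`.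
As `T = X^{1/m}`, this says that the monic polynomial `F` factors linearly over `A[[X^{1/m}]]`. -/
def FactorsLinearlyOver {K : Type u} [CommRing K] (A : Type v) [CommRing A] [Algebra K A]
    (F : (PowerSeries K)[X]) (m : ℕ) (hm : m ≠ 0) : Prop :=
  ∃ η : Fin F.natDegree → PowerSeries A, substPow A F m hm = ∏ i, (X - C (η i))

/-! By Newton–Puiseux, `F(Tᵐ, Y)` splits over `K̄[[T]]` for some `m`. Let `L` be the field generated
over `K` by the coefficients of its roots. Conjugation permutes the roots, so `L` is normal; an
automorphism of `L` is determined by its permutation of the finitely many roots, so `L` is finite.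
Hence `L = K(θ)`, and the single step `R = K[X]/(minpoly θ)` satisfies (1).

For (2), `A` is finite and unramified over `K`, hence a finite product of fields `M`. Embed such an
`M` in `K̄`. The field `L` does not depend on the exponent `m`, so a factorization over `M` forces
`L` into the image of `M`. As `L` is normal, `minpoly θ` splits in `L`, hence in each `M`, and the
roots glue to roots in `A`. -/

/-! ### Newton–Puiseux over an algebraically closed field -/

/-- Hensel-type factorization: over a complete local ring, a monic polynomial is the product of a
distinguished polynomial and a monic polynomial whose value at `0` is a unit. -/
theorem Polynomial.Monic.exists_isDistinguishedAt_mul {A : Type*} [CommRing A] [IsLocalRing A]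
    [IsAdicComplete (IsLocalRing.maximalIdeal A) A] {G : A[X]} (hG : G.Monic) :
    ∃ f h : A[X], f.IsDistinguishedAt (IsLocalRing.maximalIdeal A) ∧ h.Monic ∧
      IsUnit (h.coeff 0) ∧ G = f * h := by
  have hG0 : (G : PowerSeries A).map (IsLocalRing.residue A) ≠ 0 := by
    intro h0
    have := congrArg (PowerSeries.coeff G.natDegree) h0
    simp [hG] at this
  obtain ⟨f, u, H⟩ := PowerSeries.exists_isWeierstrassFactorization hG0
  have hf := H.isDistinguishedAt
  have hm := hf.monic
  have Hf : (f : PowerSeries A).IsWeierstrassFactorization f 1 := ⟨hf, isUnit_one, by simp⟩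
  have hdeg : ((((f : PowerSeries A).map (IsLocalRing.residue A)).order.toNat : ℕ) :
      WithBot ℕ) = f.degree := by
    rw [← Hf.natDegree_eq_toNat_order_map, degree_eq_natDegree hm.ne_zero]
  -- `G = f * u + 0` and Euclidean division of `G` by `f` are both Weierstrass divisions; uniqueness
  -- makes the unit `u` a polynomial.
  obtain ⟨hq, hr⟩ := (PowerSeries.IsWeierstrassDivisor.of_map_ne_zero
    Hf.map_ne_zero).eq_of_mul_add_eq_mul_add (q := u) (q' := ((G /ₘ f : A[X]) : PowerSeries A))
    (r := 0) (r' := G %ₘ f)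
    (by simp)
    ((degree_modByMonic_lt G hm).trans_eq hdeg.symm)
    (by
      rw [← H.eq_mul.trans (by simp : _ = (f : PowerSeries A) * u + ((0 : A[X]) : PowerSeries A)),
        ← coe_mul, ← coe_add, add_comm, modByMonic_add_div])
  have hfac : G = f * (G /ₘ f) := by
    conv_lhs => rw [← modByMonic_add_div G f, ← hr, zero_add]
  refine ⟨f, G /ₘ f, hf, hm.of_mul_monic_left (hfac ▸ hG), ?_, hfac⟩
  have := PowerSeries.isUnit_iff_constantCoeff.1 H.isUnit
  rwa [hq, ← PowerSeries.coeff_zero_eq_constantCoeff_apply, coeff_coe] at this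

/-- Used to kill the subleading coefficient by a shift, and later to see that a pure power with no
subleading term has root `0`. -/
theorem Polynomial.coeff_taylor_natDegree_sub_one {R : Type*} [CommRing R] {F : R[X]}
    (hF : F.Monic) (hn : 0 < F.natDegree) (r : R) :
    (taylor r F).coeff (F.natDegree - 1) = F.coeff (F.natDegree - 1) + F.natDegree * r := by
  obtain ⟨n, hn'⟩ : ∃ n, F.natDegree = n + 1 := ⟨_, (Nat.sub_add_cancel hn).symm⟩
  have hlead : F.coeff (n + 1) = 1 := hn' ▸ hF
  rw [taylor_coeff, eval_eq_sum_range' (n := 2)]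
  · simp [Finset.sum_range_succ, hasseDeriv_coeff, hn', add_comm 1 n, hlead,
      Nat.choose_succ_self_right]
  · have := natDegree_hasseDeriv_le F (F.natDegree - 1)
    omega

namespace PowerSeries

/-- The polynomial `F(X, Y)` splits into linear factors after some substitution `X ↦ Xᵐ`. -/
def SplitsAfterExpand {E : Type*} [CommRing E] (F : (PowerSeries E)[X]) : Prop :=
  ∃ (m : ℕ) (hm : m ≠ 0), (F.map (expand m hm : PowerSeries E →ₐ[E] PowerSeries E).toRingHom).Splits

section

variable {E : Type*} [CommRing E]

theorem map_expand_map_expand (F : (PowerSeries E)[X]) (m s : ℕ) (hm : m ≠ 0) (hs : s ≠ 0) :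
    (F.map (expand m hm : PowerSeries E →ₐ[E] PowerSeries E).toRingHom).map
      (expand s hs : PowerSeries E →ₐ[E] PowerSeries E).toRingHom =
    F.map (expand (s * m) (mul_ne_zero hs hm) : PowerSeries E →ₐ[E] PowerSeries E).toRingHom := by
  rw [Polynomial.map_map, expand_mul_eq_comp s hs m hm]
  rfl

theorem SplitsAfterExpand.of_map_expand {F : (PowerSeries E)[X]} {m : ℕ} {hm : m ≠ 0}
    (h : SplitsAfterExpand
      (F.map (expand m hm : PowerSeries E →ₐ[E] PowerSeries E).toRingHom)) :
    SplitsAfterExpand F := by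
  obtain ⟨s, hs, h⟩ := h
  exact ⟨s * m, mul_ne_zero hs hm, map_expand_map_expand F m s hm hs ▸ h⟩

theorem SplitsAfterExpand.mul {F G : (PowerSeries E)[X]} (hF : SplitsAfterExpand F)
    (hG : SplitsAfterExpand G) : SplitsAfterExpand (F * G) := by
  obtain ⟨m, hm, hF⟩ := hF
  obtain ⟨s, hs, hG⟩ := hG
  refine ⟨s * m, mul_ne_zero hs hm, ?_⟩
  rw [Polynomial.map_mul]
  refine .mul ?_ ?_
  · rw [← map_expand_map_expand F m s hm hs]
    exact hF.map _
  · simp_rw [mul_comm s m]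
    rw [← map_expand_map_expand G s m hs hm]
    exact hG.map _

theorem SplitsAfterExpand.of_taylor {F : (PowerSeries E)[X]} (a : PowerSeries E)
    (h : SplitsAfterExpand (taylor a F)) : SplitsAfterExpand F := by
  obtain ⟨m, hm, h⟩ := h
  refine ⟨m, hm, ?_⟩
  have := h.comp_X_sub_C ((expand m hm : PowerSeries E →ₐ[E] PowerSeries E).toRingHom a)
  rw [taylor_apply, Polynomial.map_comp, comp_assoc] at this
  simpa using this

theorem SplitsAfterExpand.scaleRoots [IsDomain E] {F : (PowerSeries E)[X]} (hF : F.Monic)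
    (h : SplitsAfterExpand F) (a : PowerSeries E) : SplitsAfterExpand (F.scaleRoots a) := by
  obtain ⟨m, hm, h⟩ := h
  refine ⟨m, hm, ?_⟩
  rw [map_scaleRoots _ _ _ (by simp [hF.leadingCoeff])]
  exact h.scaleRoots _

/-- After a substitution `X ↦ Xᴺ`, a monic polynomial other than `Yⁿ` can be rescaled so that its
reduction modulo `X` is not `Yⁿ`. -/
theorem exists_map_expand_eq_scaleRoots [IsDomain E] {H : (PowerSeries E)[X]} (hH : H.Monic)
    (hne : ∃ i < H.natDegree, H.coeff i ≠ 0) :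
    ∃ (N : ℕ) (hN : N ≠ 0) (d : ℕ) (G : (PowerSeries E)[X]), G.Monic ∧
      G.natDegree = H.natDegree ∧
      H.map (expand N hN : PowerSeries E →ₐ[E] PowerSeries E).toRingHom =
        G.scaleRoots (PowerSeries.X ^ d) ∧
      (∃ i < H.natDegree, constantCoeff (G.coeff i) ≠ 0) := by
  classical
  set n := H.natDegree with hn
  have hN : n.factorial ≠ 0 := n.factorial_ne_zero
  -- The Newton slopes `ord(Hᵢ)/(n - i)`, made integral by the factor `n!`; the least one over
  -- nonzero coefficients is the rescaling exponent.
  let e : ℕ → ℕ := fun i ↦ (H.coeff i).order.toNat * (n.factorial / (n - i))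
  have he : ∀ i < n, n.factorial * (H.coeff i).order.toNat = e i * (n - i) := by
    intro i hi
    have : n.factorial / (n - i) * (n - i) = n.factorial :=
      Nat.div_mul_cancel (Nat.dvd_factorial (by omega) (by omega))
    simp only [e]
    rw [mul_assoc, this, mul_comm]
  obtain ⟨i₀, hi₀, hmin⟩ := Finset.exists_min_image
    ((Finset.range n).filter fun i ↦ H.coeff i ≠ 0) e (by
      obtain ⟨i, hi, h⟩ := hne
      exact ⟨i, by simp [hi, h]⟩)
  simp only [Finset.mem_filter, Finset.mem_range] at hi₀ hmin
  have hdvd : ∀ i, ∃ g : PowerSeries E, i ≤ n →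
      expand n.factorial hN (H.coeff i) = PowerSeries.X ^ (e i₀ * (n - i)) * g := by
    intro i
    by_cases hi : i < n
    · by_cases h0 : H.coeff i = 0
      · exact ⟨0, fun _ ↦ by simp [h0]⟩
      · obtain ⟨c, hc⟩ := X_pow_order_dvd (φ := H.coeff i)
        have hle : e i₀ * (n - i) ≤ n.factorial * (H.coeff i).order.toNat := by
          rw [he i hi]
          exact Nat.mul_le_mul_right _ (hmin i ⟨hi, h0⟩)
        have : (PowerSeries.X : PowerSeries E) ^ (e i₀ * (n - i)) ∣
            expand n.factorial hN (H.coeff i) := by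
          rw [hc, map_mul, map_pow, expand_X, ← pow_mul]
          exact (pow_dvd_pow _ hle).mul_right _
        obtain ⟨g, hg⟩ := this
        exact ⟨g, fun _ ↦ hg⟩
    · refine ⟨1, fun h ↦ ?_⟩
      obtain rfl : i = n := by omega
      have : H.coeff n = 1 := hH
      simp [this]
  choose g hg using hdvd
  have hgn : g n = 1 := by
    have : H.coeff n = 1 := hH
    simpa [this] using (hg n le_rfl).symm
  let G : (PowerSeries E)[X] := ∑ i ∈ Finset.range (n + 1), Polynomial.monomial i (g i)
  have hcoeff : ∀ i, G.coeff i = if i ≤ n then g i else 0 := by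
    intro i
    simp [G, Polynomial.coeff_monomial]
  have hle : G.natDegree ≤ n := Polynomial.natDegree_le_iff_coeff_eq_zero.2 fun i hi ↦ by
    rw [hcoeff, if_neg (by omega)]
  have hGn : G.coeff n = 1 := by rw [hcoeff, if_pos le_rfl, hgn]
  have hdeg : G.natDegree = n :=
    le_antisymm hle (Polynomial.le_natDegree_of_ne_zero (by simp [hGn]))
  refine ⟨n.factorial, hN, e i₀, G, Polynomial.monic_of_natDegree_le_of_coeff_eq_one n hle hGn,
    hdeg, ?_, i₀, hi₀.1, ?_⟩
  · ext1 i
    rw [Polynomial.coeff_map, Polynomial.coeff_scaleRoots, hcoeff, hdeg]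
    split_ifs with hi
    · rw [← pow_mul, mul_comm (g i), ← hg i hi]
      rfl
    · rw [Polynomial.coeff_eq_zero_of_natDegree_lt (by omega)]
      simp
  · rw [hcoeff, if_pos hi₀.1.le]
    -- At the minimizing index the power of `X` divided out is the exact order, so the lowest
    -- coefficient of `H.coeff i₀` becomes a constant term.
    have h1 := congrArg (coeff (e i₀ * (n - i₀))) (hg i₀ hi₀.1.le)
    rw [← he i₀ hi₀.1, coeff_expand_mul, coeff_X_pow_mul', if_pos le_rfl, Nat.sub_self,
      coeff_zero_eq_constantCoeff_apply] at h1
    rw [← h1]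
    exact coeff_order hi₀.2

end

/-- **Puiseux's theorem**: over an algebraically closed field of characteristic zero, a monic
polynomial with power series coefficients splits after a substitution `X ↦ Xᵐ`. -/
theorem splitsAfterExpand_of_monic {E : Type*} [Field E] [IsAlgClosed E] [CharZero E]
    (F : (PowerSeries E)[X]) (hF : F.Monic) : SplitsAfterExpand F := by
  induction hn : F.natDegree using Nat.strong_induction_on generalizing F with
  | _ n ih =>
  subst hn
  rcases Nat.eq_zero_or_pos F.natDegree with h0 | hpos
  · exact ⟨1, one_ne_zero, .of_natDegree_eq_zero (by rw [hF.natDegree_map, h0])⟩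
  have hn0 : (F.natDegree : E) ≠ 0 := by exact_mod_cast hpos.ne'
  let c : PowerSeries E := C (-(F.natDegree : E)⁻¹) * F.coeff (F.natDegree - 1)
  refine .of_taylor c ?_
  set H := taylor c F with hH
  have hHm : H.Monic := by
    rw [hH, Monic, leadingCoeff_taylor]; exact hF
  have hHdeg : H.natDegree = F.natDegree := natDegree_taylor F c
  have hHnext : H.coeff (F.natDegree - 1) = 0 := by
    rw [hH, coeff_taylor_natDegree_sub_one hF hpos]
    have : ((F.natDegree : ℕ) : PowerSeries E) = C (F.natDegree : E) := by simp
    rw [this, ← mul_assoc, ← map_mul]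
    simp [hn0]
  by_cases hne : ∃ i < H.natDegree, H.coeff i ≠ 0
  swap
  · have : H = Polynomial.X ^ H.natDegree := by
      ext1 i
      rw [Polynomial.coeff_X_pow]
      push Not at hne
      split_ifs with h
      · rw [h]; exact hHm
      · rcases lt_or_gt_of_ne h with h | h
        · exact hne i h
        · exact Polynomial.coeff_eq_zero_of_natDegree_lt h
    refine ⟨1, one_ne_zero, ?_⟩
    rw [this]
    simp
  obtain ⟨N, hN, d, G, hGm, hGdeg, hHG, i, hi, hGi⟩ := exists_map_expand_eq_scaleRoots hHm hne
  rw [hHdeg] at hi hGdeg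
  refine .of_map_expand (hm := hN) ?_
  rw [hHG]
  refine SplitsAfterExpand.scaleRoots hGm ?_ _
  have hGnext : G.coeff (F.natDegree - 1) = 0 := by
    have := congrArg (fun P ↦ Polynomial.coeff P (F.natDegree - 1)) hHG
    simp only [Polynomial.coeff_map, hHnext, map_zero, Polynomial.coeff_scaleRoots] at this
    exact (mul_eq_zero.1 this.symm).resolve_right (pow_ne_zero _ (pow_ne_zero _ X_ne_zero))
  set Gb := G.map (constantCoeff (R := E)) with hGb
  have hGbm : Gb.Monic := hGm.map _
  have hGbdeg : Gb.natDegree = F.natDegree := by rw [hGb, hGm.natDegree_map, hGdeg]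
  -- Moving a root of the reduction to `0` lets the factorization separate the roots reducing to `0`
  -- from the others; induction applies once both factors are non-constant.
  obtain ⟨r, hr⟩ := IsAlgClosed.exists_root Gb (by
    rw [Polynomial.degree_eq_natDegree hGbm.ne_zero, hGbdeg]
    exact_mod_cast hpos.ne')
  refine .of_taylor (C r) ?_
  set G₁ := taylor (C r) G with hG₁
  have hG₁m : G₁.Monic := by rw [hG₁, Monic, leadingCoeff_taylor]; exact hGm
  have hG₁deg : G₁.natDegree = F.natDegree := by rw [hG₁, natDegree_taylor, hGdeg]
  have hmap : G₁.map (constantCoeff (R := E)) = taylor r Gb := by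
    rw [hG₁, taylor_apply, Polynomial.map_comp, taylor_apply]
    simp [hGb]
  have hmem : ∀ φ : PowerSeries E,
      φ ∈ IsLocalRing.maximalIdeal (PowerSeries E) ↔ constantCoeff φ = 0 := fun φ ↦ by
    rw [maximalIdeal_eq_span_X, Ideal.mem_span_singleton, X_dvd_iff]
  have : IsAdicComplete (IsLocalRing.maximalIdeal (PowerSeries E)) (PowerSeries E) := by
    rw [maximalIdeal_eq_span_X]; infer_instance
  obtain ⟨f, h, hf, hhm, hu, hfac⟩ := hG₁m.exists_isDistinguishedAt_mul
  have hsum : f.natDegree + h.natDegree = F.natDegree := by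
    rw [← hG₁deg, hfac, hf.monic.natDegree_mul hhm]
  have hfpos : f.natDegree ≠ 0 := by
    intro h0
    rw [hf.monic.natDegree_eq_zero.1 h0, one_mul] at hfac
    have h1 : constantCoeff (G₁.coeff 0) = 0 := by
      rw [← Polynomial.coeff_map, hmap, taylor_coeff_zero]
      exact hr
    rw [hfac] at h1
    exact ((isUnit_iff_constantCoeff.1 hu).ne_zero) h1
  -- Otherwise the reduction is `(Y - r)ⁿ`; its subleading coefficient vanishes, so `r = 0` in
  -- characteristic zero, and the reduction is `Yⁿ`, which the rescaling excluded.
  have hhpos : h.natDegree ≠ 0 := by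
    intro h0
    rw [hhm.natDegree_eq_zero.1 h0, mul_one] at hfac
    have hX : taylor r Gb = Polynomial.X ^ F.natDegree := by
      rw [← hmap]
      ext1 j
      rw [Polynomial.coeff_map, Polynomial.coeff_X_pow]
      split_ifs with hj
      · rw [hj, ← hG₁deg]
        simp [hG₁m]
      · rcases lt_or_gt_of_ne hj with hj | hj
        · rw [← hmem]
          exact hfac ▸ hf.mem (by rw [← hfac, hG₁deg]; exact hj)
        · rw [Polynomial.coeff_eq_zero_of_natDegree_lt (by omega), map_zero]
    have hr0 : r = 0 := by
      have h1 := coeff_taylor_natDegree_sub_one hGbm (hGbdeg ▸ hpos) r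
      rw [hX, hGbdeg, Polynomial.coeff_X_pow, if_neg (by omega), hGb, Polynomial.coeff_map, hGnext,
        map_zero, zero_add] at h1
      exact (mul_eq_zero.1 h1.symm).resolve_left hn0
    rw [hr0, taylor_zero] at hX
    apply hGi
    rw [← Polynomial.coeff_map, ← hGb, hX, Polynomial.coeff_X_pow, if_neg hi.ne]
  rw [hfac]
  exact (ih _ (by omega) f hf.monic rfl).mul (ih _ (by omega) h hhm rfl)

end PowerSeries


/-! ### Triangular separable algebras are reduced and Artinian -/

/-- Two roots of `p` congruent modulo a square-zero ideal differ by some `ε` with `p'(b) ε = 0`, and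
separability makes `p'(b)` a unit. -/
theorem AdjoinRoot.formallyUnramified_of_separable {k : Type u} [CommRing k] {p : k[X]}
    (hp : p.Separable) : Algebra.FormallyUnramified k (AdjoinRoot p) := by
  rw [Algebra.FormallyUnramified.iff_comp_injective]
  intro B _ _ I hI f₁ f₂ e
  refine AdjoinRoot.algHom_ext ?_
  have hmem : f₁ (root p) - f₂ (root p) ∈ I := by
    simpa [Ideal.Quotient.mk_eq_mk_iff_sub_mem] using AlgHom.congr_fun e (root p)
  have hroot : ∀ f : AdjoinRoot p →ₐ[k] B, aeval (f (root p)) p = 0 := fun f ↦ by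
    rw [aeval_algHom_apply, AdjoinRoot.aeval_eq, AdjoinRoot.mk_self, map_zero]
  have h := (p.map (algebraMap k B)).eval_add_of_sq_eq_zero (f₂ (root p))
    (f₁ (root p) - f₂ (root p))
    (show (f₁ (root p) - f₂ (root p)) ^ 2 ∈ ⊥ from hI ▸ Ideal.pow_mem_pow hmem 2)
  simp only [add_sub_cancel, eval_map_algebraMap, derivative_map, hroot, zero_add] at h
  obtain ⟨r, s, hrs⟩ := hp
  have h1 := congrArg (aeval (f₂ (root p))) hrs
  simp only [map_add, map_mul, hroot, mul_zero, zero_add, map_one] at h1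
  rw [← sub_eq_zero, ← one_mul (f₁ _ - _), ← h1, mul_assoc, ← h, mul_zero]

namespace TriangularSeparable

theorem finite_ofBase {k : Type u} [CommRing k] (R : TriangularSeparable k) :
    R.ofBase.Finite := by
  induction R with
  | nil => exact RingHom.Finite.id _
  | cons p monic _ _ T ih =>
    refine RingHom.Finite.comp ih ?_
    rw [← AdjoinRoot.algebraMap_eq, RingHom.finite_algebraMap]
    exact monic.finite_adjoinRoot

theorem formallyUnramified_ofBase {k : Type u} [CommRing k] (R : TriangularSeparable k) :
    R.ofBase.FormallyUnramified := by
  induction R with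
  | nil => exact RingHom.FormallyUnramified.of_surjective Function.surjective_id
  | cons p _ separable _ T ih =>
    refine RingHom.FormallyUnramified.comp ?_ ih
    exact RingHom.formallyUnramified_algebraMap.2
      (AdjoinRoot.formallyUnramified_of_separable separable)

variable {K : Type u} [Field K]

instance finite_alg (A : TriangularSeparable K) : Module.Finite K A.Alg :=
  A.finite_ofBase

instance formallyUnramified_alg (A : TriangularSeparable K) :
    Algebra.FormallyUnramified K A.Alg :=
  A.formallyUnramified_ofBase

instance isReduced_alg (A : TriangularSeparable K) : IsReduced A.Alg :=
  Algebra.FormallyUnramified.isReduced_of_field K A.Alg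

instance isArtinianRing_alg (A : TriangularSeparable K) : IsArtinianRing A.Alg :=
  IsArtinianRing.of_finite K A.Alg

end TriangularSeparable

/-! ### Gluing linear factorizations -/

theorem Polynomial.Splits.exists_eq_prod_X_sub_C {S : Type*} [CommRing S] [Nontrivial S] {p : S[X]}
    (h : p.Splits) (hp : p.Monic) {n : ℕ} (hn : p.natDegree = n) :
    ∃ a : Fin n → S, p = ∏ i, (X - C (a i)) := by
  obtain ⟨m, hm⟩ := splits_iff_exists_multiset.1 h
  rw [hp.leadingCoeff, C_1, one_mul] at hm
  have hcard : m.toList.length = n := by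
    rw [Multiset.length_toList, ← hn, hm, natDegree_multiset_prod_X_sub_C_eq_card]
  subst hcard
  refine ⟨fun i ↦ m.toList.get i, ?_⟩
  conv_lhs => rw [hm, ← m.coe_toList]
  rw [Multiset.map_coe, Multiset.prod_coe, ← List.prod_ofFn]
  congr 1
  conv_lhs => rw [← List.ofFn_get m.toList, List.map_ofFn]
  rfl

/-- In a reduced Artinian algebra, a monic polynomial that splits over all residue fields is a
product of linear factors. -/
theorem Polynomial.Monic.exists_map_eq_prod_X_sub_C_of_forall_quotient {k S : Type*} [CommRing k]
    [CommRing S] [Algebra k S] [IsArtinianRing S] [IsReduced S] {p : k[X]} (hp : p.Monic)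
    (h : ∀ I : MaximalSpectrum S, (p.map (algebraMap k (S ⧸ I.asIdeal))).Splits) :
    ∃ a : Fin p.natDegree → S, p.map (algebraMap k S) = ∏ i, (X - C (a i)) := by
  have key : ∀ I : MaximalSpectrum S, ∃ a : Fin p.natDegree → S ⧸ I.asIdeal,
      p.map (algebraMap k (S ⧸ I.asIdeal)) = ∏ i, (X - C (a i)) := fun I ↦
    (h I).exists_eq_prod_X_sub_C (hp.map _) (hp.natDegree_map _)
  choose a ha using key
  -- Since `S` is the product of its residue fields, any numbering of the roots in each field can be
  -- glued index by index.
  refine ⟨fun i ↦ (IsArtinianRing.equivPi S).symm fun I ↦ a I i, ?_⟩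
  have hmk : ∀ I i, Ideal.Quotient.mk I.asIdeal
      ((IsArtinianRing.equivPi S).symm fun I ↦ a I i) = a I i := fun I i ↦ by
    have := IsArtinianRing.equivPi_apply S ((IsArtinianRing.equivPi S).symm fun I ↦ a I i) I
    rw [AlgEquiv.apply_symm_apply] at this
    exact this.symm
  ext1 j
  refine (IsArtinianRing.equivPi S).injective ?_
  funext I
  rw [IsArtinianRing.equivPi_apply, IsArtinianRing.equivPi_apply]
  rw [← Polynomial.coeff_map (Ideal.Quotient.mk I.asIdeal),
    ← Polynomial.coeff_map (Ideal.Quotient.mk I.asIdeal), Polynomial.map_map,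
    ← Ideal.Quotient.algebraMap_eq, ← IsScalarTower.algebraMap_eq, ha, Polynomial.map_prod]
  simp [hmk]

/-! ### Base change and change of exponent -/

section substPow

variable {K : Type u} [Field K] {A : Type v} [CommRing A] [Algebra K A]
  {F : (PowerSeries K)[X]}

theorem substPow_monic (hF : F.Monic) (m : ℕ) (hm : m ≠ 0) : (substPow A F m hm).Monic :=
  hF.map _

theorem natDegree_substPow [Nontrivial A] (hF : F.Monic) (m : ℕ) (hm : m ≠ 0) :
    (substPow A F m hm).natDegree = F.natDegree :=
  hF.natDegree_map _

theorem factorsLinearlyOver_iff_splits [Nontrivial A] (hF : F.Monic) {m : ℕ} {hm : m ≠ 0} :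
    FactorsLinearlyOver A F m hm ↔ (substPow A F m hm).Splits := by
  refine ⟨fun ⟨η, hη⟩ ↦ ?_, fun h ↦
    h.exists_eq_prod_X_sub_C (substPow_monic hF m hm) (natDegree_substPow hF m hm)⟩
  rw [hη]
  exact Splits.prod fun i _ ↦ Splits.X_sub_C _

theorem substPow_map {B : Type*} [CommRing B] [Algebra K B] (g : A →ₐ[K] B) (m : ℕ) (hm : m ≠ 0) :
    (substPow A F m hm).map (PowerSeries.map (g : A →+* B)) = substPow B F m hm := by
  rw [substPow, substPow, Polynomial.map_map, ← RingHom.comp_assoc, ← PowerSeries.map_comp,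
    AlgHom.comp_algebraMap]

theorem substPow_map_expand (m s : ℕ) (hm : m ≠ 0) (hs : s ≠ 0) :
    (substPow A F m hm).map
      (PowerSeries.expand s hs : PowerSeries A →ₐ[A] PowerSeries A).toRingHom =
    substPow A F (s * m) (mul_ne_zero hs hm) := by
  rw [substPow, substPow, Polynomial.map_map]
  congr 1
  ext1 φ
  simp [PowerSeries.expand_mul s hs m hm]

theorem exists_splits_substPow (E : Type*) [Field E] [IsAlgClosed E] [CharZero E] [Algebra K E]
    (hF : F.Monic) : ∃ (m : ℕ) (hm : m ≠ 0), (substPow E F m hm).Splits := by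
  obtain ⟨m, hm, h⟩ := PowerSeries.splitsAfterExpand_of_monic
    (F.map (PowerSeries.map (algebraMap K E))) (hF.map _)
  refine ⟨m, hm, ?_⟩
  convert h
  rw [substPow, Polynomial.map_map]
  congr 1
  ext1 φ
  simp

end substPow

/-! ### The field of coefficients of the roots -/

section coeffField

variable {K : Type u} [Field K] {Ω : Type v} [Field Ω] [Algebra K Ω] {F : (PowerSeries K)[X]}

/-- The field generated over `K` by the coefficients of the roots `η ∈ Ω[[T]]` of `F(Tᵐ, Y)`. -/
noncomputable def rootCoeffField (Ω : Type v) [Field Ω] [Algebra K Ω] (F : (PowerSeries K)[X])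
    (m : ℕ) (hm : m ≠ 0) : IntermediateField K Ω :=
  IntermediateField.adjoin K
    {c | ∃ η ∈ (substPow Ω F m hm).roots, ∃ j, PowerSeries.coeff j η = c}

theorem rootCoeffField_le_iff {m : ℕ} {hm : m ≠ 0} {M : IntermediateField K Ω} :
    rootCoeffField Ω F m hm ≤ M ↔
      ∀ η ∈ (substPow Ω F m hm).roots, ∀ j, PowerSeries.coeff j η ∈ M := by
  rw [rootCoeffField, IntermediateField.adjoin_le_iff]
  constructor
  · exact fun h η hη j ↦ h ⟨η, hη, j, rfl⟩
  · rintro h _ ⟨η, hη, j, rfl⟩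
    exact h η hη j

theorem coeff_mem_rootCoeffField {m : ℕ} {hm : m ≠ 0} {η : PowerSeries Ω}
    (hη : η ∈ (substPow Ω F m hm).roots) (j : ℕ) :
    PowerSeries.coeff j η ∈ rootCoeffField Ω F m hm :=
  rootCoeffField_le_iff.1 le_rfl η hη j

theorem PowerSeries.map_injective_of_injective {R S : Type*} [CommRing R] [CommRing S] {f : R →+* S}
    (hf : Function.Injective f) : Function.Injective (PowerSeries.map f) := by
  intro φ ψ h
  ext j
  apply hf
  rw [← PowerSeries.coeff_map, ← PowerSeries.coeff_map, h]

theorem PowerSeries.expand_injective {R : Type*} [CommRing R] (m : ℕ) (hm : m ≠ 0) :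
    Function.Injective (PowerSeries.expand m hm : PowerSeries R →ₐ[R] PowerSeries R) := by
  intro φ ψ h
  ext j
  rw [← PowerSeries.coeff_expand_mul m hm φ, h, PowerSeries.coeff_expand_mul]

/-- The field of coefficients does not depend on the exponent. -/
theorem rootCoeffField_le_rootCoeffField {m s : ℕ} {hm : m ≠ 0} {hs : s ≠ 0}
    (h₁ : (substPow Ω F m hm).Splits) (h₂ : (substPow Ω F s hs).Splits) :
    rootCoeffField Ω F m hm ≤ rootCoeffField Ω F s hs := by
  rw [rootCoeffField_le_iff]
  intro η hη j
  -- Both root multisets, expanded, become that of exponent `s * m`; so `η(Tˢ) = μ(Tᵐ)` for some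
  -- root `μ` of exponent `s`.
  have e₁ := h₁.roots_map_of_injective
    (i := (PowerSeries.expand s hs : PowerSeries Ω →ₐ[Ω] PowerSeries Ω).toRingHom)
    (PowerSeries.expand_injective s hs)
  have e₂ := h₂.roots_map_of_injective
    (i := (PowerSeries.expand m hm : PowerSeries Ω →ₐ[Ω] PowerSeries Ω).toRingHom)
    (PowerSeries.expand_injective m hm)
  rw [substPow_map_expand] at e₁ e₂
  simp_rw [mul_comm m s] at e₂
  have hmem := Multiset.mem_map_of_mem
    (PowerSeries.expand s hs : PowerSeries Ω →ₐ[Ω] PowerSeries Ω).toRingHom hη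
  rw [← e₁, e₂, Multiset.mem_map] at hmem
  obtain ⟨μ, hμ, hμη⟩ := hmem
  replace hμη : PowerSeries.expand m hm μ = PowerSeries.expand s hs η := hμη
  rw [← PowerSeries.coeff_expand_mul s hs η, ← hμη, PowerSeries.coeff_expand]
  split_ifs
  · exact coeff_mem_rootCoeffField hμ _
  · exact zero_mem _

theorem map_mem_roots_substPow (hF : F.Monic) {m : ℕ} {hm : m ≠ 0} {E E' : Type*} [Field E]
    [Algebra K E] [Field E'] [Algebra K E'] (σ : E →ₐ[K] E') {η : PowerSeries E}
    (hη : η ∈ (substPow E F m hm).roots) :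
    PowerSeries.map (σ : E →+* E') η ∈ (substPow E' F m hm).roots := by
  rw [mem_roots (substPow_monic hF m hm).ne_zero] at hη ⊢
  rw [← substPow_map σ]
  exact hη.map

theorem normal_rootCoeffField [Normal K Ω] (hF : F.Monic) (m : ℕ) (hm : m ≠ 0) :
    Normal K (rootCoeffField Ω F m hm) := by
  rw [IntermediateField.normal_iff_forall_map_le]
  intro σ
  rw [IntermediateField.map_le_iff_le_comap, rootCoeffField_le_iff]
  intro η hη j
  exact coeff_mem_rootCoeffField (map_mem_roots_substPow hF σ hη) j

theorem splits_substPow_rootCoeffField {m : ℕ} {hm : m ≠ 0}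
    (h : (substPow Ω F m hm).Splits) :
    (substPow (rootCoeffField Ω F m hm) F m hm).Splits := by
  rw [← substPow_map (rootCoeffField Ω F m hm).val] at h
  refine Splits.of_splits_map_of_injective
    (i := PowerSeries.map ((rootCoeffField Ω F m hm).val : rootCoeffField Ω F m hm →+* Ω))
    (PowerSeries.map_injective_of_injective (rootCoeffField Ω F m hm).val.injective) h ?_
  intro η hη
  rw [substPow_map] at hη
  refine ⟨PowerSeries.mk fun j ↦ ⟨PowerSeries.coeff j η, coeff_mem_rootCoeffField hη j⟩, ?_⟩
  ext j
  simp

/-- The Galois group acts faithfully on a finite set of roots, hence is finite. -/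
theorem finiteDimensional_rootCoeffField [CharZero K] [Normal K Ω] (hF : F.Monic) {m : ℕ}
    {hm : m ≠ 0} (h : (substPow Ω F m hm).Splits) :
    FiniteDimensional K (rootCoeffField Ω F m hm) := by
  classical
  set L := rootCoeffField Ω F m hm with hL
  have : Normal K L := normal_rootCoeffField hF m hm
  have : IsGalois K L := ⟨⟩
  let act : Gal(L/K) → ((substPow L F m hm).roots.toFinset → (substPow L F m hm).roots.toFinset) :=
    fun σ η ↦ ⟨PowerSeries.map (σ.toAlgHom : L →+* L) η.1, by
      have := η.2
      rw [Multiset.mem_toFinset] at this ⊢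
      exact map_mem_roots_substPow hF σ.toAlgHom this⟩
  have hact : Function.Injective act := by
    intro σ τ hστ
    have key : σ.toAlgHom = τ.toAlgHom := by
      refine IntermediateField.algHom_ext_of_eq_adjoin K hL ?_
      rintro _ ⟨η, hη, j, rfl⟩
      rw [← substPow_map L.val, (splits_substPow_rootCoeffField h).roots_map_of_injective
        (i := PowerSeries.map (L.val : L →+* Ω))
        (PowerSeries.map_injective_of_injective L.val.injective), Multiset.mem_map] at hη
      obtain ⟨ξ, hξ, rfl⟩ := hη
      have := congrArg (fun f ↦ PowerSeries.coeff j (f ⟨ξ, Multiset.mem_toFinset.2 hξ⟩).1) hστ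
      simpa [act] using this
    ext1 x
    exact DFunLike.congr_fun key x
  have := Finite.of_injective act hact
  exact IsGalois.finiteDimensional_of_finite K L

end coeffField

/-! ### Minimality and the theorem -/

/-- A polynomial over `K` that splits in the field generated by the coefficients of the roots of
`F` splits in every field over which `F` factors linearly. -/
theorem splits_of_splits_rootCoeffField {K : Type u} [Field K] {Ω : Type v} [Field Ω]
    [Algebra K Ω] {F : (PowerSeries K)[X]} {m s : ℕ} {hm : m ≠ 0} {hs : s ≠ 0}
    (h : (substPow Ω F m hm).Splits) {p : K[X]}
    (hp : (p.map (algebraMap K (rootCoeffField Ω F m hm))).Splits)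
    {M : Type*} [Field M] [Algebra K M] (ψ : M →ₐ[K] Ω) (hM : (substPow M F s hs).Splits) :
    (p.map (algebraMap K M)).Splits := by
  have hinj : Function.Injective (PowerSeries.map (ψ : M →+* Ω)) :=
    PowerSeries.map_injective_of_injective ψ.injective
  have hs' : (substPow Ω F s hs).Splits := by
    rw [← substPow_map ψ]
    exact hM.map _
  have hle : rootCoeffField Ω F m hm ≤ ψ.fieldRange := by
    refine (rootCoeffField_le_rootCoeffField h hs').trans (rootCoeffField_le_iff.2 ?_)
    intro η hη j
    rw [← substPow_map ψ, hM.roots_map_of_injective hinj, Multiset.mem_map] at hη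
    obtain ⟨ξ, -, rfl⟩ := hη
    exact ⟨PowerSeries.coeff j ξ, by simp⟩
  have hpψ := hp.of_algHom (IntermediateField.inclusion hle)
  have := hpψ.of_algHom (AlgEquiv.ofInjectiveField ψ).symm.toAlgHom
  exact this

/-- The triangular separable algebra `K[X]/(p)` presented by a single polynomial. -/
noncomputable def TriangularSeparable.single {K : Type u} [Field K] (p : K[X]) (monic : p.Monic)
    (separable : p.Separable) (nonconstant : 0 < p.natDegree) : TriangularSeparable K :=
  .cons p monic separable nonconstant .nil

theorem mainTheorem6 {K : Type u} [Field K] [CharZero K] (F : (PowerSeries K)[X])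
    (hmonic : F.Monic) (hdeg : 0 < F.natDegree)
    (hsep : (F.map (algebraMap (PowerSeries K) (LaurentSeries K))).Separable) :
    ∃ R : TriangularSeparable K,
      (∃ (m : ℕ) (hm : 0 < m), FactorsLinearlyOver R.Alg F m hm.ne') ∧
      ∀ A : TriangularSeparable K,
        (∃ (s : ℕ) (hs : 0 < s), FactorsLinearlyOver A.Alg F s hs.ne') → A.Splits R := by
  have : CharZero (AlgebraicClosure K) := charZero_of_injective_algebraMap
    (algebraMap K (AlgebraicClosure K)).injective
  obtain ⟨m, hm, hsplit⟩ := exists_splits_substPow (AlgebraicClosure K) hmonic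
  set L := rootCoeffField (AlgebraicClosure K) F m hm
  have : Normal K L := normal_rootCoeffField hmonic m hm
  have : FiniteDimensional K L := finiteDimensional_rootCoeffField hmonic hsplit
  obtain ⟨θ, hθ⟩ := Field.exists_primitive_element K L
  have hint : IsIntegral K θ := Algebra.IsIntegral.isIntegral θ
  have hpm := minpoly.monic hint
  have hirr := minpoly.irreducible hint
  -- The isomorphism `L = K(θ) ≅ K[X]/(minpoly θ)`, along which the factorization is transported.
  let g : L →ₐ[K] AdjoinRoot (minpoly K θ) :=
    ((IntermediateField.topEquiv.symm.trans (IntermediateField.equivOfEq hθ.symm)).trans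
      (IntermediateField.adjoinRootEquivAdjoin K hint).symm).toAlgHom
  refine ⟨.single (minpoly K θ) hpm hirr.separable hirr.natDegree_pos, ?_, ?_⟩
  · refine ⟨m, Nat.pos_of_ne_zero hm, ?_⟩
    have : Fact (Irreducible (minpoly K θ)) := ⟨hirr⟩
    have hfac : FactorsLinearlyOver (AdjoinRoot (minpoly K θ)) F m hm := by
      rw [factorsLinearlyOver_iff_splits hmonic, ← substPow_map g]
      exact (splits_substPow_rootCoeffField hsplit).map _
    exact hfac
  · rintro A ⟨s, hs, η, hη⟩
    have hA : (substPow A.Alg F s hs.ne').Splits := by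
      rw [hη]
      exact Splits.prod fun i _ ↦ Splits.X_sub_C _
    obtain ⟨a, ha⟩ := hpm.exists_map_eq_prod_X_sub_C_of_forall_quotient (S := A.Alg) fun I ↦ by
      let _ : Field (A.Alg ⧸ I.asIdeal) := Ideal.Quotient.field _
      have hI := hA.map (PowerSeries.map
        ((Ideal.Quotient.mkₐ K I.asIdeal : A.Alg →ₐ[K] A.Alg ⧸ I.asIdeal) :
          A.Alg →+* A.Alg ⧸ I.asIdeal))
      rw [substPow_map] at hI
      exact splits_of_splits_rootCoeffField hsplit (Normal.splits ‹_› θ)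
        (IsAlgClosed.lift (R := K) (S := A.Alg ⧸ I.asIdeal)) hI
    -- With a single step, nothing remains to be split after choosing the roots.
    exact ⟨a, ha, fun _ ↦ trivial⟩
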